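/- Let $n\ge 0$ and let $\lambda=(\lambda_1\ge\dots\ge\lambda_n\ge 0)$ be a partition with $n$ parts, zeros allowed. A triangular array with $n$ rows is a family of nonnegative integers $x_{i,j}$ ($1\le i\le n$, $1\le j\le n-i+1$); put $x_{i,0}=0$ and $x_{n+1,j}=0$. Its shape is its first row. A Gelfand–Tsetlin pattern of shape $\lambda$ is a triangular array with first row $\lambda$ and $x_{i,j}\ge x_{i+1,j}\ge x_{i,j+1}$ for $1\le i\le n-1$, $1\le j\le n-i$. A composition array pattern of shape $\gamma=(\gamma_1,\dots,\gamma_n)\in\mathbb{Z}_{\ge0}^n$ is a triangular array with first row $\gamma$ such that $x_{i+1,j}\le x_{i,j+1}$ for $1\le i\le n-1$, $1\le j\le n-i$, and such that for all $1\le i\le n-1$ and $0\le r<s\le n-i$: * if $x_{i+1,r}\ge x_{i+1,s}$, then $x_{i+1,r}\ge x_{i,s+1}$; * if $x_{i+1,r}<x_{i+1,s}<x_{i,s+1}$, then $x_{i,r+1}<x_{i+1,s}$. Write $\mathrm{sort}(\gamma)$ for the parts of $\gamma$ in weakly decreasing order and $\gamma^+$ for $\gamma$ with its zero parts deleted. Let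 $A_\gamma$ be the set of composition array patterns of shape $\gamma$ and let $B$ be the set of Gelfand–Tsetlin patterns of shape $\lambda$. For $\mathrm{sort}(\gamma)=\lambda$, let $C_\gamma$ be the set of column-strict composition tableaux of shape $\gamma^+$ whose set of first column entries is $\{i\mid\gamma_i>0\}$. These are fillings $U$ of the left-justified diagram with row lengths $\gamma^+$ by positive integers such that the first column strictly increases downwards, rows weakly decrease from left to right, and, with $U(i,j)=0$ when row $i$ has no $j$-th box, for rows $i_1<i_2$ and $j\ge2$: if $U(i_2,j)\ne0$ and $U(i_2,j)\ge U(i_1,j)$, then $U(i_2,j)>U(i_1,j-1)$. Let $D$ be the set of reverse column-strict Young tableaux of shape $\lambda$ with entries in $\{1,\dots,n\}$ (rows weakly decrease from left to right, columns strictly decrease downwards). Define the following maps. * $\Theta$ sorts each row of a triangular array into weakly decreasing order. * $\tilde\Theta$ keeps row $n$ of a Gelfand–Tsetlin pattern and then builds rows $i=n-1,n-2,\dots,1$: it takes the entries $a$ of row $i$ from least to greatest and puts $a$ into the rightmost unoccupied position $(i,k)$ with $k>1$ such that the entry already built at $(i+1,k-1)$ is at most $a$, or into $(i,1)$ if there is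 no such $k$. * $\varphi$ sends $(x_{i,j})\in B$ to the filling of the diagram of $\lambda$ in which, for each $i$, the boxes that lie in the diagram of row $i$ of the array but not in that of row $i+1$ contain $i$. * $\psi$ sends $(x_{i,j})\in A_\gamma$ to the following filling. In the diagram with row lengths $\gamma$, for each $i$ and each $k\ge i$, the boxes of row $k$ in columns $c$ with $x_{i+1,k-i}<c\le x_{i,k-i+1}$ contain $i$; then the empty rows are deleted. * $\theta$ sorts each column of a composition tableau into decreasing order from top to bottom. Then $\Theta$ is a bijection from $\bigcup_{\mathrm{sort}(\gamma)=\lambda}A_\gamma$, the set of composition array patterns whose shape is a rearrangement of $\lambda$, onto $B$, and its inverse is $\tilde\Theta$. Moreover, for every $\gamma$ with $\mathrm{sort}(\gamma)=\lambda$, the maps $\psi:A_\gamma\to C_\gamma$, $\varphi:B\to D$ and $\theta:C_\gamma\to D$ are well defined, and $\theta\circ\psi=\varphi\circ\Theta$ on $A_\gamma$. -/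

import Mathlib

namespace CompArray

/-! Conventions.  Compositions and partitions are lists of natural numbers.  A two-index object
(a triangular array or a filling) is a function `ℕ → ℕ → ℕ`, with indices starting from `1`, which is
`0` outside its index set; for a filling, `0` means that there is no box. -/

/-- The `i`-th part of a list, counting from `1`; it is `0` for `i = 0` and beyond the length. -/
def part (l : List ℕ) (i : ℕ) : ℕ := (0 :: l).getD i 0

/-- The list sorted into weakly decreasing order (for a composition: its associated partition). -/
def sortDesc (l : List ℕ) : List ℕ := l.insertionSort (· ≥ ·)

/-- The list sorted into weakly increasing order. -/
def sortAsc (l : List ℕ) : List ℕ := l.insertionSort (· ≤ ·)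

/-- The strong composition obtained by removing the zero parts of a weak composition. -/
def strongOf (γ : List ℕ) : List ℕ := γ.filter (fun a => 0 < a)

/-- The foundation of `γ`: the set of positions (counted from `1`) of its positive parts. -/
def foundation (γ : List ℕ) : Set ℕ := {i | 0 < part γ i}

/-! ### Triangular arrays -/

/-- `x` is a triangular array with `n` rows: row `i` has entries `x i 1, …, x i (n - i + 1)`,
for `1 ≤ i ≤ n`, and `x` is `0` elsewhere. -/
def IsTriangular (n : ℕ) (x : ℕ → ℕ → ℕ) : Prop :=
  ∀ i j, ¬ (1 ≤ i ∧ 1 ≤ j ∧ i + j ≤ n + 1) → x i j = 0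

/-- The list `(x i 1, …, x i (n - i + 1))` of the entries of row `i`. -/
def rowList (n : ℕ) (x : ℕ → ℕ → ℕ) (i : ℕ) : List ℕ :=
  (List.range (n + 1 - i)).map (fun j => x i (j + 1))

/-- Gelfand–Tsetlin patterns with `n` rows and shape (first row) `lam`. -/
def GTPatterns (n : ℕ) (lam : List ℕ) : Set (ℕ → ℕ → ℕ) :=
  {x | IsTriangular n x ∧ rowList n x 1 = lam ∧
    ∀ i j, 1 ≤ i → 1 ≤ j → i + j ≤ n → x (i + 1) j ≤ x i j ∧ x i (j + 1) ≤ x (i + 1) j}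

/-- Composition array patterns with `n` rows and shape (first row) `γ`.
Here `x (i + 1) 0 = 0`, since `x` vanishes outside the triangle. -/
def compositionArrayPatterns (n : ℕ) (γ : List ℕ) : Set (ℕ → ℕ → ℕ) :=
  {x | IsTriangular n x ∧ rowList n x 1 = γ ∧
    (∀ i j, 1 ≤ i → 1 ≤ j → i + j ≤ n → x (i + 1) j ≤ x i (j + 1)) ∧
    ∀ i r s, 1 ≤ i → r < s → i + s ≤ n →
      (x (i + 1) s ≤ x (i + 1) r → x i (s + 1) ≤ x (i + 1) r) ∧
      (x (i + 1) r < x (i + 1) s → x (i + 1) s < x i (s + 1) → x i (r + 1) < x (i + 1) s)}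

/-- `Θ`: sort each row into weakly decreasing order. -/
def Theta (n : ℕ) (x : ℕ → ℕ → ℕ) : ℕ → ℕ → ℕ :=
  fun i j => if 1 ≤ i then part (sortDesc (rowList n x i)) j else 0

/-- One step of `Θ̃`.  `below` is the row underneath, already built; `occ` is the partially
filled row with positions `1, …, m` (`none` = unoccupied).  The entry `a` is put into the rightmost
unoccupied position `k ≥ 2` with `below (k - 1) ≤ a`, or into position `1` if there is none. -/
def placeEntry (below : ℕ → ℕ) (m : ℕ) (occ : ℕ → Option ℕ) (a : ℕ) : ℕ → Option ℕ :=
  Function.update occ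
    (max 1 (Nat.findGreatest (fun k => 2 ≤ k ∧ occ k = none ∧ below (k - 1) ≤ a) m)) (some a)

/-- Place the entries of the list `l`, in this order, into an empty row with `m` positions. -/
def placeRow (below : ℕ → ℕ) (m : ℕ) (l : List ℕ) : ℕ → ℕ :=
  fun k => (l.foldl (placeEntry below m) (fun _ => none) k).getD 0

/-- Row `n - d` of `Θ̃ y`, by recursion on `d`: row `n` is kept, and row `n - (d + 1)`, which has
`d + 2` positions, receives the entries of that row of `y` from least to greatest. -/
def thetaInvRow (n : ℕ) (y : ℕ → ℕ → ℕ) : ℕ → ℕ → ℕ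
  | 0 => fun k => y n k
  | d + 1 => placeRow (thetaInvRow n y d) (d + 2) (sortAsc (rowList n y (n - (d + 1))))

/-- The map `Θ̃` on triangular arrays with `n` rows. -/
def ThetaInv (n : ℕ) (y : ℕ → ℕ → ℕ) : ℕ → ℕ → ℕ :=
  fun i j => if 1 ≤ i ∧ i ≤ n then thetaInvRow n y (n - i) j else 0

/-! ### Fillings -/

/-- `U` is a filling of the diagram of `α` (row `i` has `part α i` boxes, left justified) with
positive integers, extended by `0` outside of the diagram. -/
def IsFilling (α : List ℕ) (U : ℕ → ℕ → ℕ) : Prop :=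
  ∀ i j, 0 < U i j ↔ 1 ≤ j ∧ j ≤ part α i

/-- Column-strict composition tableaux of shape `α`. The last condition is the triple rule; it is
void for `j` larger than the largest part of `α`, as then `U i₂ j = 0`. -/
def IsColumnStrictCT (α : List ℕ) (U : ℕ → ℕ → ℕ) : Prop :=
  IsFilling α U ∧
  (∀ i, 1 ≤ i → i + 1 ≤ α.length → U i 1 < U (i + 1) 1) ∧
  (∀ i j, 1 ≤ i → 1 ≤ j → j + 1 ≤ part α i → U i (j + 1) ≤ U i j) ∧
  (∀ i₁ i₂ j, 1 ≤ i₁ → i₁ < i₂ → i₂ ≤ α.length → 2 ≤ j →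
    U i₂ j ≠ 0 → U i₁ j ≤ U i₂ j → U i₁ (j - 1) < U i₂ j)

/-- Column-strict composition tableaux of shape `strongOf γ` whose first column consists of the
elements of `foundation γ`. -/
def compositionTableaux (γ : List ℕ) : Set (ℕ → ℕ → ℕ) :=
  {U | IsColumnStrictCT (strongOf γ) U ∧
    {a | ∃ i, 1 ≤ i ∧ i ≤ (strongOf γ).length ∧ U i 1 = a} = foundation γ}

/-- Reverse column-strict Young tableaux of shape `lam` with entries in `{1, …, n}`: rows weakly
decrease and columns strictly decrease. -/
def reverseTableaux (n : ℕ) (lam : List ℕ) : Set (ℕ → ℕ → ℕ) :=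
  {T | IsFilling lam T ∧ (∀ i j, T i j ≤ n) ∧
    (∀ i j, 1 ≤ i → 1 ≤ j → j + 1 ≤ part lam i → T i (j + 1) ≤ T i j) ∧
    (∀ i j, 1 ≤ i → 1 ≤ j → j ≤ part lam (i + 1) → T (i + 1) j < T i j)}

/-! ### The maps to tableaux -/

/-- `φ`: for `i = 1, …, n`, the boxes of the skew shape (row `i` of `y`) / (row `i + 1` of `y`) are
filled with `i`.  In a Gelfand–Tsetlin pattern the rows are nested, so each box belongs to
exactly one of these skew shapes. -/
def phi (n : ℕ) (y : ℕ → ℕ → ℕ) : ℕ → ℕ → ℕ :=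
  fun r c => ∑ i ∈ Finset.Icc 1 n, if y (i + 1) r < c ∧ c ≤ y i r then i else 0

/-- The filling of the diagram of the weak composition `(x 1 1, …, x 1 n)` in which, for
`i = 1, …, n`, the boxes of (row `i` of `x`) // (row `i + 1` of `x`) are filled with `i`.
Shapes are aligned at the bottom, so the `j`-th part of row `i` of `x` lies in row `i + j - 1` of the
diagram: diagram row `k` meets row `i` of `x` in `x i (k - i + 1)`. -/
def weakFilling (n : ℕ) (x : ℕ → ℕ → ℕ) : ℕ → ℕ → ℕ :=
  fun k c => ∑ i ∈ Finset.Icc 1 n,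
    if i ≤ k ∧ x (i + 1) (k - i) < c ∧ c ≤ x i (k - i + 1) then i else 0

/-- The increasing list of the positions `k` in `{1, …, n}` with `0 < x 1 k`. -/
def nonemptyRows (n : ℕ) (x : ℕ → ℕ → ℕ) : List ℕ :=
  (List.range' 1 n).filter (fun k => 0 < x 1 k)

/-- `ψ`: build the filling of the weak composition diagram, then delete its empty rows. -/
def psi (n : ℕ) (x : ℕ → ℕ → ℕ) : ℕ → ℕ → ℕ :=
  fun r c => weakFilling n x (part (nonemptyRows n x) r) c

/-- `θ`, on fillings with `k` rows: sort the entries of each column into decreasing order from top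
to bottom (missing boxes, which are zeros, end up at the bottom). -/
def columnSort (k : ℕ) (U : ℕ → ℕ → ℕ) : ℕ → ℕ → ℕ :=
  fun r c => part (sortDesc ((List.range' 1 k).map (fun i => U i c))) r

end CompArray

/-! Everything reduces to two consecutive rows. Put the lower row `b`, preceded by `b 0 = 0`, under
the upper row `a`. The conditions on a composition array pattern say that `b (k - 1) ≤ a k`, that
the intervals `(b (k - 1), a k]` are pairwise disjoint, and that `a` is arranged greedily: no `a r`
could have gone further right under a larger entry. This is `RowCompat`. For each threshold `t`,
disjointness means that the number of entries `≥ t` grows by at most one from `b` to `a`. This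
depends only on the two multisets, and after sorting it is the Gelfand–Tsetlin interlacing. The
greedy part depends on the order alone and determines it: given `b` and the multiset of `a`, the
rule of `Θ̃` finds the only greedy arrangement (`foldl_placeEntry_eq`), and interlacing guarantees
that the rule never gets stuck (`exists_foldl_placeEntry`). Working up from row `n`, this makes `Θ`
and `Θ̃` mutually inverse. For the tableaux, each box holds the largest index of the rows of the
array that cover it, so `t ≤` entry if and only if row `t` reaches column `c` (`le_sum_chain_iff`).
Both sides of the square then count the entries `≥ c` of row `t`. -/

namespace CompArray

/-! ### Parts of lists, sorting and threshold counts. -/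

theorem part_zero (l : List ℕ) : part l 0 = 0 := rfl

theorem part_succ (l : List ℕ) (j : ℕ) : part l (j + 1) = l.getD j 0 := by
  simp [part]

theorem part_cons (a : ℕ) (l : List ℕ) {j : ℕ} (hj : 1 ≤ j) : part (a :: l) (j + 1) = part l j := by
  obtain ⟨j, rfl⟩ := Nat.exists_eq_add_of_le' hj
  simp [part_succ]

theorem part_of_length_lt {l : List ℕ} {j : ℕ} (h : l.length < j) : part l j = 0 := by
  obtain ⟨j, rfl⟩ := Nat.exists_eq_add_of_le' (Nat.one_le_of_lt h)
  rw [part_succ, List.getD_eq_default]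
  omega

theorem part_mem {l : List ℕ} {j : ℕ} (h1 : 1 ≤ j) (h2 : j ≤ l.length) : part l j ∈ l := by
  obtain ⟨j, rfl⟩ := Nat.exists_eq_add_of_le' h1
  rw [part_succ, List.getD_eq_getElem _ _ (by omega)]
  exact List.getElem_mem _

theorem exists_part_of_mem {l : List ℕ} {a : ℕ} (h : a ∈ l) :
    ∃ j, 1 ≤ j ∧ j ≤ l.length ∧ part l j = a := by
  obtain ⟨j, hj, rfl⟩ := List.getElem_of_mem h
  exact ⟨j + 1, by omega, by omega, by rw [part_succ, List.getD_eq_getElem _ _ hj]⟩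

theorem part_map {f : ℕ → ℕ} (hf : f 0 = 0) (l : List ℕ) (j : ℕ) :
    part (l.map f) j = f (part l j) := by
  rcases j with _ | j
  · simp [part_zero, hf]
  · simpa [part_succ, hf] using List.getD_map (f := f) (l := l) (n := j) (d := 0)

theorem part_lt_part {l : List ℕ} (h : l.Pairwise (· < ·)) {i j : ℕ} (hi : 1 ≤ i) (hij : i < j)
    (hj : j ≤ l.length) : part l i < part l j := by
  obtain ⟨i, rfl⟩ := Nat.exists_eq_add_of_le' hi
  obtain ⟨j, rfl⟩ := Nat.exists_eq_add_of_le' (hi.trans hij.le)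
  rw [part_succ, part_succ, List.getD_eq_getElem _ _ (by omega),
    List.getD_eq_getElem _ _ (by omega)]
  exact List.pairwise_iff_getElem.1 h _ _ _ _ (by omega)

theorem sortDesc_perm (l : List ℕ) : (sortDesc l).Perm l := List.perm_insertionSort _ _

theorem sortDesc_pairwise (l : List ℕ) : (sortDesc l).Pairwise (· ≥ ·) :=
  List.pairwise_insertionSort _ _

theorem sortAsc_perm (l : List ℕ) : (sortAsc l).Perm l := List.perm_insertionSort _ _

theorem sortAsc_pairwise (l : List ℕ) : (sortAsc l).Pairwise (· ≤ ·) :=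
  List.pairwise_insertionSort _ _

theorem sortDesc_eq {l m : List ℕ} (h : l.Perm m) (hm : m.Pairwise (· ≥ ·)) : sortDesc l = m :=
  ((sortDesc_perm l).trans h).eq_of_pairwise
    (fun _ _ _ _ h1 h2 => le_antisymm h2 h1) (sortDesc_pairwise l) hm

/-- In a weakly decreasing list, the `j`-th part is at least `t` if and only if at least `j` entries
are. -/
theorem le_part_iff_of_pairwise {l : List ℕ} (h : l.Pairwise (· ≥ ·)) {t : ℕ} (ht : 1 ≤ t) (j : ℕ) :
    t ≤ part l j ↔ 1 ≤ j ∧ j ≤ l.countP (t ≤ ·) := by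
  induction l generalizing j with
  | nil =>
    rcases j with _ | j
    · simp [part_zero]; omega
    · simp [part_succ]; omega
  | cons a l ih =>
    rw [List.pairwise_cons] at h
    rcases j with _ | j
    · simp [part_zero]; omega
    by_cases hta : t ≤ a
    · rw [List.countP_cons_of_pos (by simpa using hta)]
      rcases j with _ | j
      · simp [part_succ, hta]
      · rw [part_cons _ _ (by omega), ih h.2]
        omega
    · have h0 : l.countP (t ≤ ·) = 0 := by
        rw [List.countP_eq_zero]
        intro b hb
        have := h.1 b hb
        simp only [decide_eq_true_eq]
        omega
      rw [List.countP_cons_of_neg (by simpa using hta), h0]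
      rcases j with _ | j
      · simp [part_succ, hta]
      · rw [part_cons _ _ (by omega), ih h.2, h0]
        omega

/-- Sorting enters the later arguments mostly through this equivalence, which replaces sorted lists
by counts. -/
theorem le_part_sortDesc_iff (l : List ℕ) {t : ℕ} (ht : 1 ≤ t) (j : ℕ) :
    t ≤ part (sortDesc l) j ↔ 1 ≤ j ∧ j ≤ l.countP (t ≤ ·) := by
  rw [le_part_iff_of_pairwise (sortDesc_pairwise l) ht, (sortDesc_perm l).countP_eq]

theorem eq_of_forall_pos_le_iff {a b : ℕ} (h : ∀ t, 1 ≤ t → (t ≤ a ↔ t ≤ b)) : a = b := by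
  have h1 := h a
  have h2 := h b
  omega

/-! ### Rows of an array as multisets. -/

theorem length_rowList (n : ℕ) (x : ℕ → ℕ → ℕ) (i : ℕ) : (rowList n x i).length = n + 1 - i := by
  simp [rowList]

theorem part_rowList {n : ℕ} {x : ℕ → ℕ → ℕ} (hx : IsTriangular n x) (i j : ℕ) :
    part (rowList n x i) j = x i j := by
  rcases j with _ | j
  · rw [part_zero, hx i 0 (by omega)]
  by_cases hj : j < n + 1 - i
  · rw [part_succ, List.getD_eq_getElem _ _ (by simpa [rowList] using hj)]
    simp [rowList]
  · rw [part_of_length_lt (by rw [length_rowList]; omega), hx i (j + 1) (by omega)]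

theorem coe_rowList (n : ℕ) (x : ℕ → ℕ → ℕ) (i : ℕ) :
    (rowList n x i : Multiset ℕ) = (Finset.Icc 1 (n + 1 - i)).val.map (x i) := by
  have : Finset.Icc 1 (n + 1 - i) = (Finset.range (n + 1 - i)).map ⟨(· + 1), add_left_injective 1⟩ := by
    ext k
    simp only [Finset.mem_Icc, Finset.mem_map, Finset.mem_range, Function.Embedding.coeFn_mk]
    constructor
    · intro h
      exact ⟨k - 1, by omega, by omega⟩
    · rintro ⟨a, h, rfl⟩
      omega
  rw [this, Finset.map_val, Multiset.map_map]
  rfl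

theorem countP_eq_card {l : List ℕ} {s : Finset ℕ} {a : ℕ → ℕ} (h : (l : Multiset ℕ) = s.val.map a)
    (p : ℕ → Prop) [DecidablePred p] :
    l.countP (fun v => decide (p v)) = (s.filter (fun k => p (a k))).card := by
  rw [← Multiset.coe_countP, h, Multiset.countP_map]
  rfl

theorem countP_rowList (n : ℕ) (x : ℕ → ℕ → ℕ) (i t : ℕ) :
    (rowList n x i).countP (t ≤ ·) = ((Finset.Icc 1 (n + 1 - i)).filter (fun k => t ≤ x i k)).card :=
  countP_eq_card (coe_rowList n x i) (t ≤ ·)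

/-! ### The two-row condition, split into a greedy part and a counting part. -/

/-- The relation between a row `a`, with positions `1, …, M`, of a composition array pattern and the
row `b` underneath (where `b 0 = 0`). -/
def RowCompat (M : ℕ) (b a : ℕ → ℕ) : Prop :=
  (∀ k, 1 ≤ k → k ≤ M → b (k - 1) ≤ a k) ∧
  ∀ r s, 1 ≤ r → r < s → s ≤ M → b (s - 1) < a s → a s ≤ b (r - 1) ∨ a r < b (s - 1)

/-- Entries placed greedily: position `s > r` was already occupied when `a r` was placed, if it could
have received `a r`. -/
def RowGreedy (S : Finset ℕ) (b a : ℕ → ℕ) : Prop :=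
  (∀ k ∈ S, b (k - 1) ≤ a k) ∧ ∀ r ∈ S, ∀ s ∈ S, r < s → b (s - 1) ≤ a r → a s ≤ a r

theorem RowCompat.rowGreedy {M : ℕ} {b a : ℕ → ℕ} (h : RowCompat M b a) :
    RowGreedy (Finset.Icc 1 M) b a := by
  refine ⟨fun k hk => ?_, fun r hr s hs hrs hle => ?_⟩
  · rw [Finset.mem_Icc] at hk
    exact h.1 k hk.1 hk.2
  · rw [Finset.mem_Icc] at hr hs
    have h1 := h.1 r hr.1 hr.2
    have h2 := h.1 s hs.1 hs.2
    have h3 := h.2 r s hr.1 hrs hs.2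
    omega

theorem RowCompat.count_le {M : ℕ} {b a : ℕ → ℕ} (h : RowCompat M b a) (t : ℕ) :
    ((Finset.Icc 1 M).filter (fun k => t ≤ b (k - 1))).card ≤
      ((Finset.Icc 1 M).filter (fun k => t ≤ a k)).card := by
  refine Finset.card_le_card fun k hk => ?_
  simp only [Finset.mem_filter, Finset.mem_Icc] at hk ⊢
  exact ⟨hk.1, hk.2.trans (h.1 k hk.1.1 hk.1.2)⟩

/-- A position counted for `a` but not for `b` has `t` in its interval `(b (k - 1), a k]`. These
intervals are disjoint, so there is at most one such position. -/
theorem RowCompat.count_ge {M : ℕ} {b a : ℕ → ℕ} (h : RowCompat M b a) (t : ℕ) :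
    ((Finset.Icc 1 M).filter (fun k => t ≤ a k)).card ≤
      ((Finset.Icc 1 M).filter (fun k => t ≤ b (k - 1))).card + 1 := by
  have key : ((Finset.Icc 1 M).filter (fun k => b (k - 1) < t ∧ t ≤ a k)).card ≤ 1 := by
    have aux : ∀ r s, 1 ≤ r → r < s → s ≤ M → b (r - 1) < t → t ≤ a r → b (s - 1) < t →
        t ≤ a s → False := by
      intro r s h1 h2 h3 h4 h5 h6 h7
      have := h.2 r s h1 h2 h3
      omega
    rw [Finset.card_le_one]
    intro r hr s hs
    simp only [Finset.mem_filter, Finset.mem_Icc] at hr hs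
    rcases lt_trichotomy r s with hrs | hrs | hrs
    · exact (aux r s hr.1.1 hrs hs.1.2 hr.2.1 hr.2.2 hs.2.1 hs.2.2).elim
    · exact hrs
    · exact (aux s r hs.1.1 hrs hr.1.2 hs.2.1 hs.2.2 hr.2.1 hr.2.2).elim
  refine le_trans ?_ (Nat.add_le_add_left key _)
  refine le_trans (Finset.card_le_card fun k hk => ?_) (Finset.card_union_le _ _)
  simp only [Finset.mem_filter, Finset.mem_union] at hk ⊢
  by_cases hb : t ≤ b (k - 1)
  · exact Or.inl ⟨hk.1, hb⟩
  · exact Or.inr ⟨hk.1, by omega, hk.2⟩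

/-- Two intervals sharing a threshold `t` would add two positions to the count, so the bound `+ 1`
restores disjointness; greediness supplies the strict inequality `a r < b (s - 1)`. -/
theorem RowGreedy.rowCompat {M : ℕ} {b a : ℕ → ℕ} (h : RowGreedy (Finset.Icc 1 M) b a)
    (hc : ∀ t, 1 ≤ t → ((Finset.Icc 1 M).filter (fun k => t ≤ a k)).card ≤
      ((Finset.Icc 1 M).filter (fun k => t ≤ b (k - 1))).card + 1) : RowCompat M b a := by
  have fit : ∀ k, 1 ≤ k → k ≤ M → b (k - 1) ≤ a k :=
    fun k h1 h2 => h.1 k (Finset.mem_Icc.2 ⟨h1, h2⟩)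
  have disj : ∀ t r s, 1 ≤ r → r < s → s ≤ M → b (r - 1) < t → t ≤ a r → b (s - 1) < t →
      t ≤ a s → False := by
    intro t r s h1 h2 h3 h4 h5 h6 h7
    have hsub : insert r (insert s ((Finset.Icc 1 M).filter (fun k => t ≤ b (k - 1)))) ⊆
        (Finset.Icc 1 M).filter (fun k => t ≤ a k) := by
      intro k hk
      simp only [Finset.mem_insert, Finset.mem_filter, Finset.mem_Icc] at hk ⊢
      rcases hk with rfl | rfl | hk
      · omega
      · omega
      · exact ⟨hk.1, hk.2.trans (fit k hk.1.1 hk.1.2)⟩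
    have := Finset.card_le_card hsub
    rw [Finset.card_insert_of_notMem, Finset.card_insert_of_notMem] at this
    · have := hc t (by omega)
      omega
    · simp only [Finset.mem_filter]
      omega
    · simp only [Finset.mem_insert, Finset.mem_filter]
      omega
  refine ⟨fit, fun r s h1 h2 h3 h4 => ?_⟩
  by_contra hcon
  have g := h.2 r (Finset.mem_Icc.2 ⟨h1, by omega⟩) s (Finset.mem_Icc.2 ⟨by omega, h3⟩) h2
  -- If the conclusion fails, greediness gives `a s ≤ a r`, so `a s` lies in both intervals.
  exact disj (a s) r s h1 h2 h3 (by omega) (by omega) h4 le_rfl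

/-! ### The placement rule: uniqueness and existence. -/

/-- The entry `v` goes to the rightmost admissible position, if the admissible ones are not
exhausted. -/
theorem exists_placeEntry_eq {b : ℕ → ℕ} (hb : b 0 = 0) {M : ℕ} {occ : ℕ → Option ℕ} {S : Finset ℕ}
    (hS : ∀ k, k ∈ S ↔ (1 ≤ k ∧ k ≤ M) ∧ occ k = none) {v : ℕ} (hv : ∃ k ∈ S, b (k - 1) ≤ v) :
    ∃ s ∈ S, b (s - 1) ≤ v ∧ (∀ k ∈ S, b (k - 1) ≤ v → k ≤ s) ∧
      placeEntry b M occ v = Function.update occ s (some v) := by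
  set P : ℕ → Prop := fun k => 2 ≤ k ∧ occ k = none ∧ b (k - 1) ≤ v with hP
  have hmax : ∀ k ∈ S, b (k - 1) ≤ v → k ≤ max 1 (Nat.findGreatest P M) := by
    intro k hk hkv
    rw [hS] at hk
    by_cases h2 : 2 ≤ k
    · exact (Nat.le_findGreatest hk.1.2 ⟨h2, hk.2, hkv⟩).trans (le_max_right _ _)
    · omega
  refine ⟨max 1 (Nat.findGreatest P M), ?_, ?_, hmax, rfl⟩
  all_goals
    obtain ⟨k, hk, hkv⟩ := hv
    have hle := hmax k hk hkv
    rw [hS] at hk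
    -- The value `0` means that no position `≥ 2` is admissible. The given admissible position is
    -- then `1`, which imposes no bound since `b 0 = 0`.
    by_cases h0 : Nat.findGreatest P M = 0
    · rw [h0] at hle ⊢
      have : k = 1 := by simp at hle; omega
      subst this
      simp_all
    · have h1 := Nat.findGreatest_of_ne_zero (P := P) rfl h0
      have h2 := Nat.findGreatest_le (P := P) M
      rw [max_eq_right (by omega)]
      first
      | exact (hS _).2 ⟨⟨by omega, h2⟩, h1.2.1⟩
      | exact h1.2.2

theorem mem_erase_iff_update {M : ℕ} {occ : ℕ → Option ℕ} {S : Finset ℕ}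
    (hS : ∀ k, k ∈ S ↔ (1 ≤ k ∧ k ≤ M) ∧ occ k = none) (s v k : ℕ) :
    k ∈ S.erase s ↔ (1 ≤ k ∧ k ≤ M) ∧ Function.update occ s (some v) k = none := by
  rw [Finset.mem_erase, hS]
  by_cases h : k = s
  · simp [h]
  · simp [h]

/-- Uniqueness: the rule rebuilds any greedy row from its sorted entries. Only the least entry has
to be considered, as erasing its position leaves a greedy row. -/
theorem foldl_placeEntry_eq {b : ℕ → ℕ} (hb : b 0 = 0) {M : ℕ} {a : ℕ → ℕ} (l : List ℕ)
    (hl : l.Pairwise (· ≤ ·)) (occ : ℕ → Option ℕ) (S : Finset ℕ)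
    (hS : ∀ k, k ∈ S ↔ (1 ≤ k ∧ k ≤ M) ∧ occ k = none) (ha : RowGreedy S b a)
    (hperm : (l : Multiset ℕ) = S.val.map a) (k : ℕ) :
    l.foldl (placeEntry b M) occ k = if k ∈ S then some (a k) else occ k := by
  induction l generalizing occ S with
  | nil =>
    have : S = ∅ := by
      have := hperm.symm
      simpa using this
    simp [this]
  | cons v l ih =>
    rw [List.pairwise_cons] at hl
    have hvl : ∀ k ∈ S, v ≤ a k := by
      intro k hk
      have : a k ∈ ((v :: l : List ℕ) : Multiset ℕ) := by
        rw [hperm]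
        exact Multiset.mem_map_of_mem _ hk
      rcases List.mem_cons.1 (Multiset.mem_coe.1 this) with h | h
      · exact h.ge
      · exact hl.1 _ h
    obtain ⟨r, hr, hrv⟩ : ∃ r ∈ S, a r = v := by
      have : v ∈ S.val.map a := by
        rw [← hperm]
        simp
      simpa using this
    have hbr := ha.1 r hr
    obtain ⟨s, hs, hsv, hmax, heq⟩ := exists_placeEntry_eq hb hS ⟨r, hr, hrv ▸ hbr⟩
    -- Some position `r` holds `v` and is admissible, so `r ≤ s`. If `r < s`, greediness forces `a s
    -- ≤ v`, and `v` is minimal.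
    have hasv : a s = v := by
      have h1 := hmax r hr (hrv ▸ hbr)
      rcases h1.eq_or_lt with h | h
      · rw [← h, hrv]
      · have := ha.2 r hr s hs h (by omega)
        have := hvl s hs
        omega
    rw [List.foldl_cons, heq, ih hl.2 _ (S.erase s) (mem_erase_iff_update hS s v)
      ⟨fun k hk => ha.1 k (Finset.mem_of_mem_erase hk), fun r hr s hs =>
        ha.2 r (Finset.mem_of_mem_erase hr) s (Finset.mem_of_mem_erase hs)⟩]
    · by_cases hk : k = s
      · subst hk
        simp [hs, hasv]
      · simp [hk]
    · rw [← Finset.insert_erase hs, Finset.insert_val_of_notMem (Finset.notMem_erase _ _),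
        Multiset.map_cons, hasv, ← Multiset.cons_coe, Multiset.cons_inj_right] at hperm
      exact hperm

/-- Existence: `hc` is a Hall condition. It makes the least entry placeable and survives its
placement. -/
theorem exists_foldl_placeEntry {b : ℕ → ℕ} (hb : b 0 = 0) {M : ℕ} (l : List ℕ)
    (hl : l.Pairwise (· ≤ ·)) (occ : ℕ → Option ℕ) (S : Finset ℕ)
    (hS : ∀ k, k ∈ S ↔ (1 ≤ k ∧ k ≤ M) ∧ occ k = none) (hlen : l.length = S.card)
    (hc : ∀ v, l.countP (· ≤ v) ≤ (S.filter (fun k => b (k - 1) ≤ v)).card) :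
    ∃ a : ℕ → ℕ, RowGreedy S b a ∧ (l : Multiset ℕ) = S.val.map a ∧
      ∀ k, l.foldl (placeEntry b M) occ k = if k ∈ S then some (a k) else occ k := by
  induction l generalizing occ S with
  | nil =>
    have : S = ∅ := by
      rw [List.length_nil] at hlen
      exact Finset.card_eq_zero.1 hlen.symm
    subst this
    exact ⟨fun _ => 0, ⟨by simp, by simp⟩, by simp, by simp⟩
  | cons v l ih =>
    rw [List.pairwise_cons] at hl
    have hex : ∃ k ∈ S, b (k - 1) ≤ v := by
      have h1 := hc v
      rw [List.countP_cons_of_pos (by simp)] at h1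
      obtain ⟨k, hk⟩ := Finset.card_pos.1 (lt_of_lt_of_le (Nat.succ_pos _) h1)
      rw [Finset.mem_filter] at hk
      exact ⟨k, hk⟩
    obtain ⟨s, hs, hsv, hmax, heq⟩ := exists_placeEntry_eq hb hS hex
    obtain ⟨a, ⟨hfit, hgr⟩, hperm, hfold⟩ := ih hl.2 (Function.update occ s (some v)) (S.erase s)
      (mem_erase_iff_update hS s v)
      (by rw [Finset.card_erase_of_mem hs, ← hlen, List.length_cons, Nat.add_sub_cancel]) (by
        intro w
        -- For `w ≥ v` both sides of the Hall condition drop by one; for `w < v` no entry is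
        -- counted.
        by_cases hvw : v ≤ w
        · have h1 := hc w
          rw [List.countP_cons_of_pos (by simpa using hvw)] at h1
          rw [Finset.filter_erase, Finset.card_erase_of_mem
            (Finset.mem_filter.2 ⟨hs, show b (s - 1) ≤ w from hsv.trans hvw⟩)]
          omega
        · have : l.countP (· ≤ w) = 0 := by
            rw [List.countP_eq_zero]
            intro u hu
            have := hl.1 u hu
            simp only [decide_eq_true_eq]
            omega
          rw [this]
          exact Nat.zero_le _)
    have hmem : ∀ k ∈ S, k ≠ s → k ∈ S.erase s := fun k hk h => Finset.mem_erase.2 ⟨h, hk⟩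
    have hva : ∀ k ∈ S.erase s, v ≤ a k := by
      intro k hk
      have : a k ∈ (l : Multiset ℕ) := by
        rw [hperm]
        exact Multiset.mem_map_of_mem _ hk
      exact hl.1 _ (Multiset.mem_coe.1 this)
    refine ⟨Function.update a s v, ⟨fun k hk => ?_, fun p hp q hq hpq hle => ?_⟩, ?_, fun k => ?_⟩
    · by_cases h : k = s
      · subst h
        simpa using hsv
      · simpa [h] using hfit k (hmem k hk h)
    · by_cases h1 : p = s
      · subst h1
        rw [Function.update_self] at hle
        have := hmax q hq hle
        omega
      · rw [Function.update_of_ne h1] at hle ⊢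
        by_cases h2 : q = s
        · subst h2
          rw [Function.update_self]
          exact hva p (hmem p hp h1)
        · rw [Function.update_of_ne h2]
          exact hgr p (hmem p hp h1) q (hmem q hq h2) hpq hle
    · rw [← Finset.insert_erase hs, Finset.insert_val_of_notMem (Finset.notMem_erase _ _),
        Multiset.map_cons, Function.update_self, ← Multiset.cons_coe, Multiset.cons_inj_right, hperm]
      refine Multiset.map_congr rfl fun k hk => ?_
      rw [Function.update_of_ne (Finset.ne_of_mem_erase hk)]
    · rw [List.foldl_cons, heq, hfold]
      by_cases hk : k = s
      · subst hk
        simp [hs]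
      · simp [hk]

theorem placeRow_eq_self {b : ℕ → ℕ} (hb : b 0 = 0) {M : ℕ} {a : ℕ → ℕ} {l : List ℕ}
    (hl : l.Pairwise (· ≤ ·)) (ha : RowGreedy (Finset.Icc 1 M) b a)
    (hperm : (l : Multiset ℕ) = (Finset.Icc 1 M).val.map a)
    (h0 : ∀ k, k ∉ Finset.Icc 1 M → a k = 0) : placeRow b M l = a := by
  funext k
  rw [placeRow, foldl_placeEntry_eq hb l hl _ (Finset.Icc 1 M) (by simp) ha hperm]
  by_cases hk : k ∈ Finset.Icc 1 M
  · simp only [hk, if_true, Option.getD_some]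
  · simp only [hk, if_false, Option.getD_none, h0 k hk]

/-- The two halves of interlacing play different roles: the lower bound, read on complements, is the
Hall condition, and the upper bound turns greedy into compatible. -/
theorem placeRow_spec {b : ℕ → ℕ} (hb : b 0 = 0) {M : ℕ} {l : List ℕ}
    (hl : l.Pairwise (· ≤ ·)) (hlen : l.length = M)
    (hc : ∀ t, 1 ≤ t →
      ((Finset.Icc 1 M).filter (fun k => t ≤ b (k - 1))).card ≤ l.countP (t ≤ ·) ∧
      l.countP (t ≤ ·) ≤ ((Finset.Icc 1 M).filter (fun k => t ≤ b (k - 1))).card + 1) :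
    RowCompat M b (placeRow b M l) ∧
      (l : Multiset ℕ) = (Finset.Icc 1 M).val.map (placeRow b M l) ∧
      ∀ k, k ∉ Finset.Icc 1 M → placeRow b M l k = 0 := by
  obtain ⟨a, hgr, hperm, hfold⟩ := exists_foldl_placeEntry (M := M) hb l hl (fun _ => none) (Finset.Icc 1 M)
    (by simp) (by simp [hlen]) (by
      intro v
      have h1 := (hc (v + 1) (by omega)).1
      have h2 := List.length_eq_countP_add_countP (fun u => decide (u ≤ v)) (l := l)
      have h3 := Finset.card_filter_add_card_filter_not (s := Finset.Icc 1 M)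
        (fun k => b (k - 1) ≤ v)
      have h4 : l.countP (fun u => !decide (u ≤ v)) = l.countP (v + 1 ≤ ·) :=
        List.countP_congr fun u _ => by simp
      have h5 : ((Finset.Icc 1 M).filter (fun k => ¬ b (k - 1) ≤ v)) =
          (Finset.Icc 1 M).filter (fun k => v + 1 ≤ b (k - 1)) :=
        Finset.filter_congr fun u _ => by omega
      simp only [decide_eq_true_eq] at h2
      rw [h5, Nat.card_Icc] at h3
      have h6 : l.countP (fun u => decide ¬ (u ≤ v)) = l.countP (v + 1 ≤ ·) :=
        List.countP_congr fun u _ => by simp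
      omega)
  have hrow : ∀ k ∈ Finset.Icc 1 M, placeRow b M l k = a k := by
    intro k hk
    rw [placeRow, hfold, if_pos hk, Option.getD_some]
  have hperm' : (l : Multiset ℕ) = (Finset.Icc 1 M).val.map (placeRow b M l) := by
    rw [hperm]
    exact Multiset.map_congr rfl fun k hk => (hrow k hk).symm
  refine ⟨RowGreedy.rowCompat ⟨fun k hk => ?_, fun r hr s hs => ?_⟩ fun t ht => ?_, hperm',
    fun k hk => ?_⟩
  · rw [hrow k hk]
    exact hgr.1 k hk
  · rw [hrow r hr, hrow s hs]
    exact hgr.2 r hr s hs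
  · rw [← countP_eq_card hperm' (t ≤ ·)]
    exact (hc t ht).2
  · rw [placeRow, hfold, if_neg hk, Option.getD_none]

/-! ### Composition array patterns row by row, and interlacing as a count. -/

theorem mem_compositionArrayPatterns_iff {n : ℕ} {γ : List ℕ} {x : ℕ → ℕ → ℕ} :
    x ∈ compositionArrayPatterns n γ ↔ IsTriangular n x ∧ rowList n x 1 = γ ∧
      ∀ i, 1 ≤ i → i < n → RowCompat (n + 1 - i) (x (i + 1)) (x i) := by
  constructor
  · rintro ⟨hx, hγ, h1, h2⟩
    refine ⟨hx, hγ, fun i hi hin => ⟨fun k hk hkn => ?_, fun r s hr hrs hs hlt => ?_⟩⟩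
    · rcases hk.eq_or_lt with rfl | hk
      · rw [hx (i + 1) (1 - 1) (by omega)]
        exact Nat.zero_le _
      · have := h1 i (k - 1) hi (by omega) (by omega)
        rwa [Nat.sub_add_cancel (by omega)] at this
    · have := h2 i (r - 1) (s - 1) hi (by omega) (by omega)
      rw [Nat.sub_add_cancel (by omega), Nat.sub_add_cancel (by omega)] at this
      omega
  · rintro ⟨hx, hγ, h⟩
    refine ⟨hx, hγ, fun i j hi hj hij => ?_, fun i r s hi hrs his => ?_⟩
    · simpa using (h i hi (by omega)).1 (j + 1) (by omega) (by omega)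
    · have h1 := (h i hi (by omega)).1 (r + 1) (by omega) (by omega)
      have h2 := (h i hi (by omega)).2 (r + 1) (s + 1) (by omega) (by omega) (by omega)
      simp only [Nat.add_sub_cancel] at h1 h2
      omega

theorem card_filter_shift {b : ℕ → ℕ} (hb : b 0 = 0) (m : ℕ) {t : ℕ} (ht : 1 ≤ t) :
    ((Finset.Icc 1 (m + 1)).filter (fun k => t ≤ b (k - 1))).card =
      ((Finset.Icc 1 m).filter (fun k => t ≤ b k)).card := by
  refine Finset.card_nbij' (fun k => k - 1) (fun k => k + 1) ?_ ?_ ?_ ?_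
  · intro k hk
    simp only [Finset.coe_filter, Finset.mem_Icc, Set.mem_ofPred_eq] at hk ⊢
    have : k ≠ 1 := by
      rintro rfl
      simp only [Nat.sub_self, hb] at hk
      omega
    exact ⟨by omega, hk.2⟩
  · intro k hk
    simp only [Finset.coe_filter, Finset.mem_Icc, Set.mem_ofPred_eq, Nat.add_sub_cancel] at hk ⊢
    exact ⟨by omega, hk.2⟩
  · intro k hk
    simp only [Finset.coe_filter, Finset.mem_Icc, Set.mem_ofPred_eq] at hk
    exact Nat.sub_add_cancel hk.1.1
  · intro k _
    exact Nat.add_sub_cancel k 1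

theorem countP_rowList_succ {n : ℕ} {x : ℕ → ℕ → ℕ} {i : ℕ} (h0 : x (i + 1) 0 = 0) (hin : i ≤ n)
    {t : ℕ} (ht : 1 ≤ t) : (rowList n x (i + 1)).countP (t ≤ ·) =
      ((Finset.Icc 1 (n + 1 - i)).filter (fun k => t ≤ x (i + 1) (k - 1))).card := by
  rw [countP_rowList, show n + 1 - i = (n + 1 - (i + 1)) + 1 by omega, card_filter_shift h0 _ ht]

/-- Row `i` of `x` interlaces with row `i + 1`, after sorting. -/
def RowInterlace (n : ℕ) (x : ℕ → ℕ → ℕ) (i : ℕ) : Prop :=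
  ∀ t, 1 ≤ t → (rowList n x (i + 1)).countP (t ≤ ·) ≤ (rowList n x i).countP (t ≤ ·) ∧
    (rowList n x i).countP (t ≤ ·) ≤ (rowList n x (i + 1)).countP (t ≤ ·) + 1

theorem RowCompat.rowInterlace {n : ℕ} {x : ℕ → ℕ → ℕ} {i : ℕ} (h0 : x (i + 1) 0 = 0)
    (hin : i ≤ n) (h : RowCompat (n + 1 - i) (x (i + 1)) (x i)) : RowInterlace n x i := by
  intro t ht
  rw [countP_rowList_succ h0 hin ht, countP_rowList n x i]
  exact ⟨h.count_le t, h.count_ge t⟩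

/-! ### Gelfand–Tsetlin patterns in terms of counts. -/

section GelfandTsetlin

variable {n : ℕ} {lam : List ℕ} {y : ℕ → ℕ → ℕ}

theorem row_pairwise (hy : y ∈ GTPatterns n lam) {i : ℕ} (hi : 1 ≤ i) :
    (rowList n y i).Pairwise (· ≥ ·) := by
  have hstep : ∀ j, y i (j + 1 + 1) ≤ y i (j + 1) := by
    intro j
    by_cases hj : i + (j + 1) ≤ n
    · have := hy.2.2 i (j + 1) hi (by omega) hj
      omega
    · rw [hy.1 i (j + 1 + 1) (by omega)]
      exact Nat.zero_le _
  have hanti : Antitone fun j => y i (j + 1) := antitone_nat_of_succ_le hstep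
  rw [rowList, List.pairwise_map]
  exact List.pairwise_lt_range.imp fun h => hanti h.le

theorem le_row_iff (hy : y ∈ GTPatterns n lam) {i : ℕ} (hi : 1 ≤ i) {t : ℕ} (ht : 1 ≤ t) (j : ℕ) :
    t ≤ y i j ↔ 1 ≤ j ∧ j ≤ (rowList n y i).countP (t ≤ ·) := by
  rw [← part_rowList hy.1, le_part_iff_of_pairwise (row_pairwise hy hi) ht]

theorem gt_rowInterlace (hy : y ∈ GTPatterns n lam) {i : ℕ} (hi : 1 ≤ i) : RowInterlace n y i := by
  intro t ht
  constructor
  · rcases Nat.eq_zero_or_pos ((rowList n y (i + 1)).countP (t ≤ ·)) with h | h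
    · rw [h]
      exact Nat.zero_le _
    · have h1 := (le_row_iff hy (by omega) ht _).2 ⟨h, le_rfl⟩
      have h2 : i + (rowList n y (i + 1)).countP (t ≤ ·) ≤ n := by
        by_contra hc
        rw [hy.1 _ _ (by omega)] at h1
        omega
      exact ((le_row_iff hy hi ht _).1 (h1.trans (hy.2.2 i _ hi h h2).1)).2
  · obtain h | ⟨j, hj⟩ : (rowList n y i).countP (t ≤ ·) ≤ 1 ∨
        ∃ j, (rowList n y i).countP (t ≤ ·) = j + 1 + 1 := by
      by_cases h : (rowList n y i).countP (t ≤ ·) ≤ 1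
      · exact Or.inl h
      · exact Or.inr ⟨(rowList n y i).countP (t ≤ ·) - 2, by omega⟩
    · omega
    · have h1 := (le_row_iff hy hi ht (j + 1 + 1)).2 ⟨by omega, hj.ge⟩
      have h2 : i + (j + 1) ≤ n := by
        by_contra hc
        rw [hy.1 _ _ (by omega)] at h1
        omega
      have h3 := (le_row_iff hy (by omega) ht _).1
        (h1.trans (hy.2.2 i (j + 1) hi (by omega) h2).2)
      omega

end GelfandTsetlin

/-! ### The sorting map `Θ`. -/

theorem Theta_apply {n : ℕ} (x : ℕ → ℕ → ℕ) {i : ℕ} (hi : 1 ≤ i) (j : ℕ) :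
    Theta n x i j = part (sortDesc (rowList n x i)) j := if_pos hi

theorem Theta_isTriangular (n : ℕ) (x : ℕ → ℕ → ℕ) : IsTriangular n (Theta n x) := by
  intro i j h
  by_cases hi : 1 ≤ i
  · rw [Theta_apply x hi]
    rcases Nat.eq_zero_or_pos j with rfl | hj
    · exact part_zero _
    · refine part_of_length_lt ?_
      rw [(sortDesc_perm _).length_eq, length_rowList]
      omega
  · exact if_neg hi

theorem rowList_Theta (n : ℕ) (x : ℕ → ℕ → ℕ) {i : ℕ} (hi : 1 ≤ i) :
    rowList n (Theta n x) i = sortDesc (rowList n x i) := by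
  have hlen : (sortDesc (rowList n x i)).length = n + 1 - i := by
    rw [(sortDesc_perm _).length_eq, length_rowList]
  refine List.ext_getElem (by rw [hlen, length_rowList]) fun j h1 h2 => ?_
  have h3 : (rowList n (Theta n x) i)[j] = Theta n x i (j + 1) := by simp [rowList]
  rw [h3, Theta_apply x hi, part_succ, List.getD_eq_getElem _ _ h2]

theorem Theta_mem_GTPatterns {n : ℕ} {γ lam : List ℕ} (hγ : sortDesc γ = lam) {x : ℕ → ℕ → ℕ}
    (hx : x ∈ compositionArrayPatterns n γ) : Theta n x ∈ GTPatterns n lam := by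
  rw [mem_compositionArrayPatterns_iff] at hx
  obtain ⟨htri, hrow, hc⟩ := hx
  refine ⟨Theta_isTriangular n x, by rw [rowList_Theta n x le_rfl, hrow, hγ],
    fun i j hi hj hij => ?_⟩
  have hI := (hc i hi (by omega)).rowInterlace (htri _ _ (by omega)) (by omega)
  rw [Theta_apply x hi, Theta_apply x hi, Theta_apply x (by omega)]
  constructor
  · rcases Nat.eq_zero_or_pos (part (sortDesc (rowList n x (i + 1))) j) with h | h
    · rw [h]
      exact Nat.zero_le _
    · have h1 := (le_part_sortDesc_iff _ h j).1 le_rfl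
      exact (le_part_sortDesc_iff _ h j).2 ⟨hj, h1.2.trans (hI _ h).1⟩
  · rcases Nat.eq_zero_or_pos (part (sortDesc (rowList n x i)) (j + 1)) with h | h
    · rw [h]
      exact Nat.zero_le _
    · have h1 := (le_part_sortDesc_iff _ h (j + 1)).1 le_rfl
      have h2 := (hI _ h).2
      exact (le_part_sortDesc_iff _ h j).2 ⟨hj, by omega⟩

/-! ### The map `Θ̃` and the inverse relations. -/

section ThetaInv

variable {n : ℕ}

theorem ThetaInv_last (hn : 1 ≤ n) (y : ℕ → ℕ → ℕ) : ThetaInv n y n = y n := by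
  funext j
  simp [ThetaInv, hn, thetaInvRow]

theorem ThetaInv_row {i : ℕ} (hi : 1 ≤ i) (hin : i < n) (y : ℕ → ℕ → ℕ) :
    ThetaInv n y i =
      placeRow (ThetaInv n y (i + 1)) (n + 1 - i) (sortAsc (rowList n y i)) := by
  obtain ⟨d, rfl⟩ : ∃ d, n = i + (d + 1) := ⟨n - i - 1, by omega⟩
  have h : ThetaInv (i + (d + 1)) y (i + 1) = thetaInvRow (i + (d + 1)) y d := by
    funext j
    rw [ThetaInv, if_pos (by omega), show i + (d + 1) - (i + 1) = d by omega]
  funext j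
  rw [h, ThetaInv, if_pos (by omega), show i + (d + 1) - i = d + 1 by omega, thetaInvRow,
    show i + (d + 1) - (d + 1) = i by omega, show i + (d + 1) + 1 - i = d + 2 by omega]

theorem ThetaInv_Theta {γ : List ℕ} {x : ℕ → ℕ → ℕ} (hx : x ∈ compositionArrayPatterns n γ) :
    ThetaInv n (Theta n x) = x := by
  rw [mem_compositionArrayPatterns_iff] at hx
  obtain ⟨htri, -, hc⟩ := hx
  have hrow : ∀ i, i ≤ n → 1 ≤ i → ThetaInv n (Theta n x) i = x i := by
    intro i hin
    induction hin using Nat.decreasingInduction with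
    | self =>
      intro hn
      rw [ThetaInv_last hn]
      funext j
      rw [← part_rowList (Theta_isTriangular n x), rowList_Theta n x hn, ← part_rowList htri]
      congr 1
      -- Row `n` has a single entry, so it is already sorted.
      refine sortDesc_eq (List.Perm.refl _) ?_
      simp [rowList]
    | of_succ i hin ih =>
      intro hi
      rw [ThetaInv_row hi hin, ih (by omega)]
      refine placeRow_eq_self (htri _ _ (by omega)) (sortAsc_pairwise _)
        (hc i hi hin).rowGreedy ?_ fun k hk => ?_
      · rw [← coe_rowList, Multiset.coe_eq_coe, rowList_Theta n x hi]
        exact (sortAsc_perm _).trans (sortDesc_perm _)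
      · rw [Finset.mem_Icc] at hk
        exact htri _ _ (by omega)
  funext i
  by_cases h : 1 ≤ i ∧ i ≤ n
  · exact hrow i h.2 h.1
  · funext j
    rw [ThetaInv, if_neg h, htri i j (by omega)]

theorem ThetaInv_spec {lam : List ℕ} {y : ℕ → ℕ → ℕ} (hy : y ∈ GTPatterns n lam) :
    IsTriangular n (ThetaInv n y) ∧
      (∀ i, 1 ≤ i → i ≤ n → (rowList n (ThetaInv n y) i).Perm (rowList n y i)) ∧
      ∀ i, 1 ≤ i → i < n → RowCompat (n + 1 - i) (ThetaInv n y (i + 1)) (ThetaInv n y i) := by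
  have key : ∀ i, i ≤ n → 1 ≤ i →
      (∀ k, k ∉ Finset.Icc 1 (n + 1 - i) → ThetaInv n y i k = 0) ∧
      (rowList n (ThetaInv n y) i).Perm (rowList n y i) ∧
      (i < n → RowCompat (n + 1 - i) (ThetaInv n y (i + 1)) (ThetaInv n y i)) := by
    intro i hin
    induction hin using Nat.decreasingInduction with
    | self =>
      intro hn
      refine ⟨fun k hk => ?_, ?_, fun h => (lt_irrefl _ h).elim⟩
      · rw [Finset.mem_Icc] at hk
        rw [ThetaInv_last hn, hy.1 _ _ (by omega)]
      · rw [rowList, ThetaInv_last hn, rowList]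
    | of_succ i hin ih =>
      intro hi
      obtain ⟨h0, hperm, -⟩ := ih (by omega)
      have h00 := h0 0 (by simp)
      have hs := placeRow_spec h00 (M := n + 1 - i) (sortAsc_pairwise (rowList n y i))
        (by rw [(sortAsc_perm _).length_eq, length_rowList]) (by
          intro t ht
          rw [← countP_rowList_succ h00 hin.le ht, hperm.countP_eq, (sortAsc_perm _).countP_eq]
          exact gt_rowInterlace hy hi t ht)
      rw [← ThetaInv_row hi hin] at hs
      refine ⟨hs.2.2, ?_, fun _ => hs.1⟩
      rw [← Multiset.coe_eq_coe, coe_rowList, ← hs.2.1, Multiset.coe_eq_coe]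
      exact sortAsc_perm _
  refine ⟨fun i j h => ?_, fun i hi hin => (key i hin hi).2.1,
    fun i hi hin => (key i hin.le hi).2.2 hin⟩
  by_cases hi : 1 ≤ i ∧ i ≤ n
  · exact (key i hi.2 hi.1).1 j (by rw [Finset.mem_Icc]; omega)
  · exact if_neg hi

theorem Theta_ThetaInv {lam : List ℕ} {y : ℕ → ℕ → ℕ} (hy : y ∈ GTPatterns n lam) :
    Theta n (ThetaInv n y) = y := by
  funext i j
  by_cases h : 1 ≤ i ∧ i ≤ n
  · rw [Theta_apply _ h.1, sortDesc_eq ((ThetaInv_spec hy).2.1 i h.1 h.2) (row_pairwise hy h.1),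
      part_rowList hy.1]
  · rw [Theta_isTriangular n _ i j (by omega), hy.1 i j (by omega)]

theorem ThetaInv_mem {lam : List ℕ} {y : ℕ → ℕ → ℕ}
    (hy : y ∈ GTPatterns n lam) : sortDesc (rowList n (ThetaInv n y) 1) = lam ∧
      ThetaInv n y ∈ compositionArrayPatterns n (rowList n (ThetaInv n y) 1) := by
  obtain ⟨h1, -, h3⟩ := ThetaInv_spec hy
  refine ⟨?_, mem_compositionArrayPatterns_iff.2 ⟨h1, rfl, h3⟩⟩
  rw [← rowList_Theta n _ le_rfl, Theta_ThetaInv hy, hy.2.1]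

end ThetaInv

/-! ### Fillings of nested chains and the map `φ`. -/

/-- The value at `c` of the filling of a chain of nested intervals `(0, f n] ⊆ … ⊆ (0, f 1]`. -/
theorem le_sum_chain_iff {n : ℕ} {f : ℕ → ℕ} (hf : ∀ i, 1 ≤ i → f (i + 1) ≤ f i)
    (h0 : f (n + 1) = 0) {c : ℕ} (hc : 1 ≤ c) {t : ℕ} (ht : 1 ≤ t) :
    t ≤ (∑ i ∈ Finset.Icc 1 n, if f (i + 1) < c ∧ c ≤ f i then i else 0) ↔ c ≤ f t := by
  have hanti : ∀ i j, 1 ≤ i → i ≤ j → f j ≤ f i := by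
    intro i j hi hij
    induction j, hij using Nat.le_induction with
    | base => exact le_rfl
    | succ j hj ih => exact (hf j (by omega)).trans ih
  by_cases h1 : c ≤ f 1
  -- Only the last interval containing `c` contributes to the sum, whose value is therefore its
  -- index `g`.
  · set g := Nat.findGreatest (fun i => c ≤ f i) n with hg
    have hn : 1 ≤ n := by
      by_contra hn
      have : n = 0 := by omega
      rw [this, Nat.zero_add] at h0
      omega
    have hg1 : 1 ≤ g := Nat.le_findGreatest hn h1
    have hgn : g ≤ n := Nat.findGreatest_le n
    have hgf : c ≤ f g := Nat.findGreatest_spec (P := fun i => c ≤ f i) hn h1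
    have hgs : f (g + 1) < c := by
      by_contra hcon
      rcases hgn.eq_or_lt with h | h
      · rw [h, h0] at hcon
        omega
      · have := Nat.le_findGreatest (P := fun i => c ≤ f i) (n := n) (m := g + 1) h (by omega)
        omega
    rw [Finset.sum_eq_single_of_mem g (Finset.mem_Icc.2 ⟨hg1, hgn⟩), if_pos ⟨hgs, hgf⟩]
    · constructor
      · intro h
        exact hgf.trans (hanti t g ht h)
      · intro h
        by_contra hcon
        have := hanti (g + 1) t (by omega) (by omega)
        omega
    · intro i hi hne
      rw [Finset.mem_Icc] at hi
      rw [if_neg]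
      rintro ⟨h2, h3⟩
      rcases Nat.lt_or_gt_of_ne hne with h | h
      · have := hanti (i + 1) g (by omega) h
        omega
      · have := hanti (g + 1) i (by omega) h
        omega
  · rw [Finset.sum_eq_zero]
    · have := hanti 1 t le_rfl ht
      omega
    · intro i hi
      rw [Finset.mem_Icc] at hi
      have := hanti 1 i le_rfl hi.1
      rw [if_neg]
      omega

section phi

variable {n : ℕ} {lam : List ℕ} {y : ℕ → ℕ → ℕ}

theorem phi_zero_right (n : ℕ) (y : ℕ → ℕ → ℕ) (r : ℕ) : phi n y r 0 = 0 := by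
  simp [phi]

theorem le_phi_iff (hy : y ∈ GTPatterns n lam) (r : ℕ) {c : ℕ} (hc : 1 ≤ c) {t : ℕ} (ht : 1 ≤ t) :
    t ≤ phi n y r c ↔ c ≤ y t r := by
  refine le_sum_chain_iff (f := fun i => y i r) (fun i hi => ?_) (hy.1 _ _ (by omega)) hc ht
  by_cases h : 1 ≤ r ∧ i + r ≤ n
  · exact (hy.2.2 i r hi h.1 h.2).1
  · rw [hy.1 (i + 1) r (by omega)]
    exact Nat.zero_le _

theorem phi_mem_reverseTableaux (hy : y ∈ GTPatterns n lam) :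
    phi n y ∈ reverseTableaux n lam := by
  have hlam : ∀ r, part lam r = y 1 r := fun r => by rw [← hy.2.1, part_rowList hy.1]
  refine ⟨fun r c => ?_, fun r c => ?_, fun r c hr hc hcl => ?_, fun r c hr hc hcl => ?_⟩
  · rcases Nat.eq_zero_or_pos c with rfl | hc
    · simp [phi_zero_right]
    · rw [hlam, ← le_phi_iff hy r hc le_rfl]
      omega
  · rcases Nat.eq_zero_or_pos c with rfl | hc
    · simp [phi_zero_right]
    · by_contra hcon
      have := (le_phi_iff hy r hc (t := n + 1) (by omega)).1 (by omega)
      rw [hy.1 _ _ (by omega)] at this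
      omega
  · rcases Nat.eq_zero_or_pos (phi n y r (c + 1)) with h | h
    · rw [h]
      exact Nat.zero_le _
    · have := (le_phi_iff hy r (Nat.succ_pos c) h).1 le_rfl
      exact (le_phi_iff hy r hc h).2 (by omega)
  · rw [hlam] at hcl
    have h1 := (le_phi_iff hy (r + 1) hc le_rfl).2 hcl
    have h2 := (le_phi_iff hy (r + 1) hc h1).1 le_rfl
    have h3 : phi n y (r + 1) c + r ≤ n := by
      by_contra hcon
      rw [hy.1 _ _ (by omega)] at h2
      omega
    exact (le_phi_iff hy r hc (by omega)).2 (h2.trans (hy.2.2 _ r h1 hr h3).2)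

end phi

/-! ### The map `ψ` to composition tableaux. -/

section psi

variable {n : ℕ} {γ : List ℕ} {x : ℕ → ℕ → ℕ}

theorem weakFilling_zero_right (n : ℕ) (x : ℕ → ℕ → ℕ) (k : ℕ) : weakFilling n x k 0 = 0 := by
  simp [weakFilling]

theorem diagonal_le (hx : x ∈ compositionArrayPatterns n γ) (k : ℕ) {i : ℕ} (hi : 1 ≤ i) :
    x (i + 1) (k - i) ≤ x i (k + 1 - i) := by
  by_cases h : i + 1 ≤ k ∧ k ≤ n
  · have := hx.2.2.1 i (k - i) hi (by omega) (by omega)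
    rwa [show k - i + 1 = k + 1 - i by omega] at this
  · rw [hx.1 _ _ (by omega)]
    exact Nat.zero_le _

/-- Diagram row `k` is filled by the chain `x i (k + 1 - i)`, an antidiagonal of the array. For `i >
k` the truncated index is `0`, where `x` vanishes. -/
theorem le_weakFilling_iff (hx : x ∈ compositionArrayPatterns n γ) (k : ℕ) {c : ℕ} (hc : 1 ≤ c)
    {t : ℕ} (ht : 1 ≤ t) : t ≤ weakFilling n x k c ↔ c ≤ x t (k + 1 - t) := by
  rw [← le_sum_chain_iff (n := n) (f := fun i => x i (k + 1 - i)) (fun i hi => ?_)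
    (hx.1 _ _ (by omega)) hc ht, weakFilling]
  · apply iff_of_eq
    congr 1
    refine Finset.sum_congr rfl fun i hi => ?_
    rw [Finset.mem_Icc] at hi
    rw [show k + 1 - (i + 1) = k - i by omega]
    by_cases hik : i ≤ k
    · rw [show k - i + 1 = k + 1 - i by omega]
      simp [hik]
    · rw [show k + 1 - i = 0 by omega, hx.1 i 0 (by omega), if_neg (by omega), if_neg (by omega)]
  · rw [show k + 1 - (i + 1) = k - i by omega]
    exact diagonal_le hx k hi

theorem psi_eq (n : ℕ) (x : ℕ → ℕ → ℕ) (r c : ℕ) :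
    psi n x r c = weakFilling n x (part (nonemptyRows n x) r) c := rfl

theorem mem_nonemptyRows {k : ℕ} : k ∈ nonemptyRows n x ↔ 1 ≤ k ∧ k ≤ n ∧ 0 < x 1 k := by
  simp only [nonemptyRows, List.mem_filter, List.mem_range'_1, decide_eq_true_eq]
  omega

theorem nonemptyRows_pairwise (n : ℕ) (x : ℕ → ℕ → ℕ) : (nonemptyRows n x).Pairwise (· < ·) :=
  (List.pairwise_lt_range' ..).filter _

theorem strongOf_eq (hγ : rowList n x 1 = γ) : strongOf γ = (nonemptyRows n x).map (x 1) := by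
  rw [← hγ, strongOf, rowList, nonemptyRows, List.range'_eq_map_range, List.filter_map,
    List.filter_map, List.map_map, Nat.add_sub_cancel]
  simp only [Function.comp_def, Nat.add_comm 1]

theorem length_strongOf (hγ : rowList n x 1 = γ) :
    (strongOf γ).length = (nonemptyRows n x).length := by
  rw [strongOf_eq hγ, List.length_map]

/-- Positivity passes down the antidiagonal: comparison with `x (j + 1) 0 = 0` shows that a zero
entry would force a zero above it. So all of the rows `1, …, k` reach column `1`. -/
theorem weakFilling_one (hx : x ∈ compositionArrayPatterns n γ) {k : ℕ} (hk : k ∈ nonemptyRows n x) :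
    weakFilling n x k 1 = k := by
  rw [mem_nonemptyRows] at hk
  have hpos : ∀ j, 1 ≤ j → j ≤ k → 0 < x j (k + 1 - j) := by
    intro j hj hjk
    induction j, hj using Nat.le_induction with
    | base => simpa using hk.2.2
    | succ j hj ih =>
      have h1 := ih (by omega)
      have h2 := (hx.2.2.2 j 0 (k - j) hj (by omega) (by omega)).1
      rw [hx.1 (j + 1) 0 (by omega), show k - j + 1 = k + 1 - j by omega] at h2
      rw [show k + 1 - (j + 1) = k - j by omega]
      omega
  refine eq_of_forall_pos_le_iff fun t ht => ?_
  rw [le_weakFilling_iff hx k le_rfl ht]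
  constructor
  · intro h
    by_contra hcon
    rw [hx.1 _ _ (by omega)] at h
    omega
  · exact hpos t ht

theorem psi_isFilling (hx : x ∈ compositionArrayPatterns n γ) : IsFilling (strongOf γ) (psi n x) := by
  intro r c
  rw [psi_eq, strongOf_eq hx.2.1, part_map (hx.1 1 0 (by omega))]
  rcases Nat.eq_zero_or_pos c with rfl | hc
  · simp [weakFilling_zero_right]
  · have := le_weakFilling_iff hx (part (nonemptyRows n x) r) hc le_rfl
    rw [Nat.add_sub_cancel] at this
    rw [← this]
    omega

/-- The triple rule is the pattern condition at array row `v`, the entry in question: row `v + 1`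
stops before column `c` in both diagram rows, while row `v` reaches `c` in row `k₂` and, if the rule
failed, `c - 1` in row `k₁`. -/
theorem weakFilling_triple (hx : x ∈ compositionArrayPatterns n γ) {k₁ k₂ c : ℕ}
    (hk : k₁ < k₂) (hk₂ : k₂ ≤ n) (hc : 2 ≤ c) (h0 : weakFilling n x k₂ c ≠ 0)
    (hle : weakFilling n x k₁ c ≤ weakFilling n x k₂ c) :
    weakFilling n x k₁ (c - 1) < weakFilling n x k₂ c := by
  set v := weakFilling n x k₂ c with hv
  have hv1 : 1 ≤ v := Nat.one_le_iff_ne_zero.2 h0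
  have h1 := (le_weakFilling_iff hx k₂ (by omega) hv1).1 le_rfl
  have h2 := le_weakFilling_iff hx k₂ (c := c) (by omega) (t := v + 1) (by omega)
  have h3 := le_weakFilling_iff hx k₁ (c := c) (by omega) (t := v + 1) (by omega)
  have h4 := le_weakFilling_iff hx k₁ (c := c - 1) (by omega) hv1
  rw [Nat.add_sub_add_right] at h2 h3
  by_contra hcon
  rw [not_lt, h4] at hcon
  have hvk : v ≤ k₁ := by
    by_contra hvk
    rw [hx.1 _ _ (by omega)] at hcon
    omega
  have h5 := hx.2.2.2 v (k₁ - v) (k₂ - v) hv1 (by omega) (by omega)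
  rw [show k₁ - v + 1 = k₁ + 1 - v by omega, show k₂ - v + 1 = k₂ + 1 - v by omega] at h5
  omega

theorem psi_mem_compositionTableaux (hx : x ∈ compositionArrayPatterns n γ) :
    psi n x ∈ compositionTableaux γ := by
  have hlen := length_strongOf hx.2.1
  have hmem : ∀ i, 1 ≤ i → i ≤ (strongOf γ).length → part (nonemptyRows n x) i ∈ nonemptyRows n x :=
    fun i h1 h2 => part_mem h1 (hlen ▸ h2)
  have hfirst : ∀ i, 1 ≤ i → i ≤ (strongOf γ).length → psi n x i 1 = part (nonemptyRows n x) i :=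
    fun i h1 h2 => weakFilling_one hx (hmem i h1 h2)
  refine ⟨⟨psi_isFilling hx, fun i hi hil => ?_, fun i j hi hj _ => ?_,
    fun i₁ i₂ j h1 h12 h2 hj h0 hle => ?_⟩, ?_⟩
  · rw [hfirst i hi (by omega), hfirst (i + 1) (by omega) hil]
    exact part_lt_part (nonemptyRows_pairwise n x) hi (Nat.lt_succ_self i) (by omega)
  · rw [psi_eq, psi_eq]
    rcases Nat.eq_zero_or_pos (weakFilling n x (part (nonemptyRows n x) i) (j + 1)) with h | h
    · rw [h]
      exact Nat.zero_le _
    · have := (le_weakFilling_iff hx _ (Nat.succ_pos j) h).1 le_rfl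
      exact (le_weakFilling_iff hx _ hj h).2 (by omega)
  · exact weakFilling_triple hx
      (part_lt_part (nonemptyRows_pairwise n x) h1 h12 (by omega))
      (mem_nonemptyRows.1 (hmem i₂ (by omega) h2)).2.1 hj h0 hle
  · ext a
    have hγ : part γ a = x 1 a := by rw [← hx.2.1, part_rowList hx.1]
    have ha : a ∈ foundation γ ↔ a ∈ nonemptyRows n x := by
      rw [mem_nonemptyRows, foundation, Set.mem_ofPred_eq, hγ]
      refine ⟨fun h => ?_, fun h => h.2.2⟩
      by_contra hcon
      rw [hx.1 _ _ (by omega)] at h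
      omega
    rw [ha, Set.mem_ofPred_eq]
    constructor
    · rintro ⟨i, h1, h2, rfl⟩
      rw [hfirst i h1 h2]
      exact hmem i h1 h2
    · intro h
      obtain ⟨i, h1, h2, rfl⟩ := exists_part_of_mem h
      exact ⟨i, h1, by omega, hfirst i h1 (by omega)⟩

end psi

/-! ### Column sorting and the commuting square. -/

theorem le_columnSort_iff (k : ℕ) (U : ℕ → ℕ → ℕ) (r c : ℕ) {t : ℕ} (ht : 1 ≤ t) :
    t ≤ columnSort k U r c ↔ 1 ≤ r ∧ r ≤ (List.range' 1 k).countP (fun i => t ≤ U i c) := by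
  rw [columnSort, le_part_sortDesc_iff _ ht, List.countP_map]
  rfl

theorem map_part_range' (l : List ℕ) : (List.range' 1 l.length).map (part l) = l := by
  refine List.ext_getElem (by simp) fun j h1 h2 => ?_
  rw [List.getElem_map, List.getElem_range', Nat.one_mul, Nat.add_comm, part_succ,
    List.getD_eq_getElem _ _ h2]

theorem countP_range'_part (l : List ℕ) (p : ℕ → Bool) :
    (List.range' 1 l.length).countP (fun i => p (part l i)) = l.countP p := by
  conv_rhs => rw [← map_part_range' l, List.countP_map]
  rfl

theorem countP_eq_sub_of_eq_range' (n m : ℕ) (p : ℕ → Bool) (hm : m ≤ n)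
    (hp : ∀ k, 1 ≤ k → k ≤ m → p k = false) :
    (List.range' 1 n).countP p = (List.range (n - m)).countP (fun j => p (j + 1 + m)) := by
  obtain ⟨d, rfl⟩ := Nat.exists_eq_add_of_le hm
  rw [← List.range'_append_1, List.countP_append, Nat.add_sub_cancel_left,
    List.range'_eq_map_range (s := 1 + m), List.countP_map, List.countP_eq_zero.2, Nat.zero_add]
  · refine List.countP_congr fun j _ => ?_
    simp only [Function.comp_apply]
    rw [show 1 + m + j = j + 1 + m by omega]
  · intro k hk
    rw [List.mem_range'_1] at hk
    simp [hp k hk.1 (by omega)]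

theorem columnSort_psi {n : ℕ} {γ lam : List ℕ} (hγ : sortDesc γ = lam) {x : ℕ → ℕ → ℕ}
    (hx : x ∈ compositionArrayPatterns n γ) :
    columnSort (strongOf γ).length (psi n x) = phi n (Theta n x) := by
  have hT := Theta_mem_GTPatterns hγ hx
  funext r c
  refine eq_of_forall_pos_le_iff fun t ht => ?_
  rw [le_columnSort_iff _ _ _ _ ht, length_strongOf hx.2.1]
  rcases Nat.eq_zero_or_pos c with rfl | hc
  · rw [phi_zero_right, List.countP_eq_zero.2]
    · omega
    · intro i _
      rw [psi_eq, weakFilling_zero_right]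
      simp only [decide_eq_true_eq]
      omega
  rw [le_phi_iff hT r hc ht, Theta_apply x ht, le_part_sortDesc_iff _ hc]
  suffices h : (List.range' 1 (nonemptyRows n x).length).countP (fun i => t ≤ psi n x i c) =
      (rowList n x t).countP (c ≤ ·) by rw [h]
  have h1 := countP_range'_part (nonemptyRows n x) (fun k => t ≤ weakFilling n x k c)
  rw [show (fun i => decide (t ≤ psi n x i c)) =
    fun i => decide (t ≤ weakFilling n x (part (nonemptyRows n x) i) c) from rfl, h1, nonemptyRows, List.countP_filter]
  -- Deleting empty rows does not change the count, because a row with a box in column `c` has `x 1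
  -- k ≥ c > 0`.
  have h2 : ∀ k, (decide (t ≤ weakFilling n x k c) && decide (0 < x 1 k)) =
      decide (c ≤ x t (k + 1 - t)) := by
    intro k
    rw [← Bool.decide_and, decide_eq_decide, le_weakFilling_iff hx k hc ht]
    refine ⟨fun h => h.1, fun h => ⟨h, ?_⟩⟩
    have h3 : 1 ≤ weakFilling n x k c := ht.trans ((le_weakFilling_iff hx k hc ht).2 h)
    have h4 := (le_weakFilling_iff hx k hc le_rfl).1 h3
    rw [Nat.add_sub_cancel] at h4
    omega
  simp only [h2]
  by_cases htn : t ≤ n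
  · rw [countP_eq_sub_of_eq_range' n (t - 1) _ (by omega), rowList, List.countP_map,
      show n - (t - 1) = n + 1 - t by omega]
    · refine List.countP_congr fun j _ => ?_
      simp only [Function.comp_apply]
      rw [show j + 1 + (t - 1) + 1 - t = j + 1 by omega]
    · intro k _ hk
      rw [show k + 1 - t = 0 by omega, hx.1 t 0 (by omega)]
      simp only [decide_eq_false_iff_not]
      omega
  · rw [countP_rowList, List.countP_eq_zero.2, show n + 1 - t = 0 by omega]
    · simp
    · intro k _
      rw [hx.1 t _ (by omega)]
      simp only [decide_eq_true_eq]
      omega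

/-! ### The image of `θ`. -/

section columnSort

variable {γ : List ℕ} {U : ℕ → ℕ → ℕ}

theorem IsColumnStrictCT.first_column_lt {α : List ℕ} (hU : IsColumnStrictCT α U) {i j : ℕ}
    (hi : 1 ≤ i) (hij : i < j) (hj : j ≤ α.length) : U i 1 < U j 1 := by
  induction j, hij using Nat.le_induction with
  | base => exact hU.2.1 i hi hj
  | succ j hij ih => exact (ih (by omega)).trans (hU.2.1 j (by omega) hj)

theorem IsColumnStrictCT.row_le {α : List ℕ} (hU : IsColumnStrictCT α U) {i : ℕ} (hi : 1 ≤ i)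
    {c : ℕ} (hc : 1 ≤ c) : U i (c + 1) ≤ U i c := by
  by_cases h : c + 1 ≤ part α i
  · exact hU.2.2.1 i c hi hc h
  · have := hU.1 i (c + 1)
    omega

theorem IsColumnStrictCT.le_first {α : List ℕ} (hU : IsColumnStrictCT α U) {i : ℕ} (hi : 1 ≤ i)
    {c : ℕ} (hc : 1 ≤ c) : U i c ≤ U i 1 := by
  induction c, hc using Nat.le_induction with
  | base => exact le_rfl
  | succ c hc ih => exact (hU.row_le hi hc).trans ih

/-- Beyond the first column, equal entries would give `U i (c - 1) < U i c` by the triple rule,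
against weakly decreasing rows. -/
theorem IsColumnStrictCT.column_ne {α : List ℕ} (hU : IsColumnStrictCT α U) {i j c : ℕ}
    (hi : 1 ≤ i) (hij : i < j) (hj : j ≤ α.length) (h0 : U j c ≠ 0) : U i c ≠ U j c := by
  intro h
  have hc : 1 ≤ c := ((hU.1 j c).1 (Nat.pos_of_ne_zero h0)).1
  rcases hc.eq_or_lt with rfl | hc
  · exact (hU.first_column_lt hi hij hj).ne h
  · have h1 := hU.2.2.2 i j c hi hij hj hc h0 h.le
    have h2 := hU.row_le hi (c := c - 1) (by omega)
    rw [Nat.sub_add_cancel (by omega)] at h2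
    omega

/-- Distinctness within a column, as a count; it yields strict decrease after sorting. -/
theorem IsColumnStrictCT.countP_le_succ {α : List ℕ} (hU : IsColumnStrictCT α U) (c : ℕ) {t : ℕ}
    (ht : 1 ≤ t) : (List.range' 1 α.length).countP (fun i => t ≤ U i c) ≤
      (List.range' 1 α.length).countP (fun i => t + 1 ≤ U i c) + 1 := by
  have hcard : ∀ p : ℕ → Prop, ∀ [DecidablePred p],
      (List.range' 1 α.length).countP (fun i => decide (p i)) =
        ((Finset.Icc 1 α.length).filter p).card := by
    intro p _
    refine countP_eq_card (a := id) ?_ p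
    rw [Multiset.map_id, Nat.Icc_eq_range']
    simp
  rw [hcard (fun i => t ≤ U i c), hcard (fun i => t + 1 ≤ U i c)]
  have hone : ((Finset.Icc 1 α.length).filter (fun i => U i c = t)).card ≤ 1 := by
    rw [Finset.card_le_one]
    intro i hi j hj
    simp only [Finset.mem_filter, Finset.mem_Icc] at hi hj
    rcases lt_trichotomy i j with h | h | h
    · exact (hU.column_ne (c := c) hi.1.1 h hj.1.2 (by omega) (by omega)).elim
    · exact h
    · exact (hU.column_ne (c := c) hj.1.1 h hi.1.2 (by omega) (by omega)).elim
  refine le_trans ?_ (Nat.add_le_add_left hone _)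
  refine le_trans (Finset.card_le_card fun k hk => ?_) (Finset.card_union_le _ _)
  simp only [Finset.mem_filter, Finset.mem_union] at hk ⊢
  by_cases h : t + 1 ≤ U k c
  · exact Or.inl ⟨hk.1, h⟩
  · exact Or.inr ⟨hk.1, by omega⟩

theorem columnSort_mem_reverseTableaux (hU : U ∈ compositionTableaux γ) :
    columnSort (strongOf γ).length U ∈ reverseTableaux γ.length (sortDesc γ) := by
  obtain ⟨hct, hfound⟩ := hU
  have hfill : IsFilling (sortDesc γ) (columnSort (strongOf γ).length U) := by
    intro r c
    have h1 := le_columnSort_iff (strongOf γ).length U r c le_rfl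
    rcases Nat.eq_zero_or_pos c with rfl | hc
    · rw [List.countP_eq_zero.2] at h1
      · omega
      · intro i _
        have := hct.1 i 0
        simp only [decide_eq_true_eq]
        omega
    · have h2 : (List.range' 1 (strongOf γ).length).countP (fun i => 1 ≤ U i c) =
          γ.countP (c ≤ ·) := by
        rw [List.countP_congr (q := fun i => decide (c ≤ part (strongOf γ) i)),
          countP_range'_part (strongOf γ) (fun a => decide (c ≤ a)), strongOf, List.countP_filter]
        · refine List.countP_congr fun a _ => ?_
          simp only [Bool.and_eq_true, decide_eq_true_eq]
          omega
        · intro i _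
          have := hct.1 i c
          simp only [decide_eq_true_eq]
          omega
      rw [h2, ← le_part_sortDesc_iff _ hc] at h1
      omega
  refine ⟨hfill, fun r c => ?_, fun r c hr hc _ => ?_, fun r c hr hc hcl => ?_⟩
  · rcases Nat.eq_zero_or_pos (columnSort (strongOf γ).length U r c) with h | h
    · rw [h]
      exact Nat.zero_le _
    · have h1 := (le_columnSort_iff _ U r c h).1 le_rfl
      obtain ⟨i, hi, hle⟩ := List.countP_pos_iff.1 (show 0 < _ from h1.1.trans h1.2)
      rw [List.mem_range'_1] at hi
      rw [decide_eq_true_eq] at hle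
      -- An entry is at most the first entry of its row, which lies in the foundation and so is at
      -- most the length of `γ`.
      refine hle.trans ((hct.le_first hi.1 ((hfill r c).1 h).1).trans ?_)
      have hf : U i 1 ∈ foundation γ := by
        rw [← hfound]
        exact ⟨i, hi.1, by omega, rfl⟩
      by_contra hcon
      rw [foundation, Set.mem_ofPred_eq, part_of_length_lt (by omega)] at hf
      omega
  · rcases Nat.eq_zero_or_pos (columnSort (strongOf γ).length U r (c + 1)) with h | h
    · rw [h]
      exact Nat.zero_le _
    · have h1 := (le_columnSort_iff _ U r (c + 1) h).1 le_rfl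
      refine (le_columnSort_iff _ U r c h).2 ⟨hr, h1.2.trans (List.countP_mono_left fun i hi => ?_)⟩
      rw [List.mem_range'_1] at hi
      have := hct.row_le hi.1 hc
      simp only [decide_eq_true_eq]
      omega
  · have h := (hfill (r + 1) c).2 ⟨hc, hcl⟩
    have h1 := (le_columnSort_iff _ U (r + 1) c h).1 le_rfl
    have h2 := hct.countP_le_succ c h
    exact (le_columnSort_iff _ U r c (Nat.succ_pos _)).2
      ⟨hr, Nat.le_of_succ_le_succ (h1.2.trans h2)⟩

end columnSort

end CompArray

theorem theorem3p3p4 (n : ℕ) (lam : List ℕ) (hlen : lam.length = n)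
    (hdec : lam.Pairwise (· ≥ ·)) :
    Set.BijOn (CompArray.Theta n)
      (⋃ γ ∈ {γ : List ℕ | CompArray.sortDesc γ = lam}, CompArray.compositionArrayPatterns n γ)
      (CompArray.GTPatterns n lam) ∧
    Set.InvOn (CompArray.ThetaInv n) (CompArray.Theta n)
      (⋃ γ ∈ {γ : List ℕ | CompArray.sortDesc γ = lam}, CompArray.compositionArrayPatterns n γ)
      (CompArray.GTPatterns n lam) ∧
    Set.MapsTo (CompArray.phi n) (CompArray.GTPatterns n lam) (CompArray.reverseTableaux n lam) ∧
    ∀ γ : List ℕ, CompArray.sortDesc γ = lam →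
      Set.MapsTo (CompArray.psi n) (CompArray.compositionArrayPatterns n γ)
        (CompArray.compositionTableaux γ) ∧
      Set.MapsTo (CompArray.columnSort (CompArray.strongOf γ).length)
        (CompArray.compositionTableaux γ) (CompArray.reverseTableaux n lam) ∧
      ∀ x ∈ CompArray.compositionArrayPatterns n γ,
        CompArray.columnSort (CompArray.strongOf γ).length (CompArray.psi n x) =
          CompArray.phi n (CompArray.Theta n x) := by
  have hinv : Set.InvOn (CompArray.ThetaInv n) (CompArray.Theta n)
      (⋃ γ ∈ {γ : List ℕ | CompArray.sortDesc γ = lam}, CompArray.compositionArrayPatterns n γ)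
      (CompArray.GTPatterns n lam) := by
    refine ⟨fun x hx => ?_, fun y hy => CompArray.Theta_ThetaInv hy⟩
    simp only [Set.mem_iUnion] at hx
    obtain ⟨γ, -, hx⟩ := hx
    exact CompArray.ThetaInv_Theta hx
  refine ⟨hinv.bijOn (fun x hx => ?_) fun y hy => ?_, hinv,
    fun y hy => CompArray.phi_mem_reverseTableaux hy, fun γ hγ =>
    ⟨fun x hx => CompArray.psi_mem_compositionTableaux hx, fun U hU => ?_,
      fun x hx => CompArray.columnSort_psi hγ hx⟩⟩
  · simp only [Set.mem_iUnion] at hx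
    obtain ⟨γ, hγ, hx⟩ := hx
    exact CompArray.Theta_mem_GTPatterns hγ hx
  · simp only [Set.mem_iUnion]
    exact ⟨_, (CompArray.ThetaInv_mem hy).1, (CompArray.ThetaInv_mem hy).2⟩
  · have h := CompArray.columnSort_mem_reverseTableaux hU
    rwa [hγ, ← (CompArray.sortDesc_perm γ).length_eq, hγ, hlen] at h
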